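/- Let $G$ be a finite group, and write $\mathrm{Irr}(G)$ for the set of characters of its irreducible complex representations. For $\chi\in\mathrm{Irr}(G)$ put $\ker(\chi)=\{g\in G:\chi(g)=\chi(1)\}$ and $Z(\chi)=\{g\in G:|\chi(g)|=\chi(1)\}$. We say that $\chi$ has central type if $\chi(g)=0$ for every $g\in G\setminus Z(\chi)$, and that $G$ is a GVZ-group if every $\chi\in\mathrm{Irr}(G)$ has central type. For a normal subgroup $N$ of $G$, write $\mathrm{Irr}(G\mid N)=\{\chi\in\mathrm{Irr}(G): N\not\le\ker(\chi)\}$. Theorem. Let $N$ be a nontrivial normal subgroup of a finite group $G$, and suppose that every character $\chi\in\mathrm{Irr}(G\mid N)$ has central type. Let $p$ be a prime and let $S$ be a Sylow $p$-subgroup of $G$. Then the following hold. (1) $S\cap Z(G)=Z(S)$. (2) If $\vartheta\in\mathrm{Irr}(S)$ and $N\not\le\ker(\vartheta)$ (as subsets of $G$; $N$ need not be contained in $S$), then $\vartheta$ has central type. (3) If $S\cap N=1$, then $S$ is a GVZ-group. -/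

import Mathlib

namespace PartialGVZ

/-- `Irr(G)`: the set of characters of irreducible complex representations of `G` of finite
dimension. Every such representation is, in a basis, one on `ℂⁿ`. -/
def Irr (G : Type*) [Group G] : Set (G → ℂ) :=
  {χ | ∃ (n : ℕ) (ρ : Representation ℂ G (Fin n → ℂ)), ρ.IsIrreducible ∧ χ = ρ.character}

/-- The kernel `ker(χ) = {g | χ(g) = χ(1)}` of a character `χ`. -/
def charKer {G : Type*} [Group G] (χ : G → ℂ) : Set G :=
  {g | χ g = χ 1}

/-- The center `Z(χ) = {g | |χ(g)| = χ(1)}` of a character `χ`. -/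
def charCenter {G : Type*} [Group G] (χ : G → ℂ) : Set G :=
  {g | (‖χ g‖ : ℂ) = χ 1}

/-- `Irr(G | N)`: the irreducible characters of `G` whose kernel does not contain `N`. -/
def IrrRel {G : Type*} [Group G] (N : Subgroup G) : Set (G → ℂ) :=
  {χ | χ ∈ Irr G ∧ ¬ (N : Set G) ⊆ charKer χ}

/-- An irreducible character `χ` has central type if it vanishes on `G \ Z(χ)`. -/
def HasCentralType {G : Type*} [Group G] (χ : G → ℂ) : Prop :=
  ∀ g : G, g ∉ charCenter χ → χ g = 0

/-- `G` is a GVZ-group if all its irreducible characters have central type. -/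
def IsGVZGroup (G : Type*) [Group G] : Prop :=
  ∀ χ ∈ Irr G, HasCentralType χ

end PartialGVZ

namespace PartialGVZ

open Matrix Representation
open scoped ComplexOrder

/-! Let χ in Irr(G | N) have degree n. Orthogonality and central type give n² = |G : Z(χ)|. Let σ,
of degree d, be a constituent of χ restricted to S, and put T = S ∩ Z(χ). Then |S : T| is the p-part
of n². The restriction vanishes off T, and T acts on both spaces by the same scalars, so σ has
multiplicity nd / |S : T|. Integrality forces d² ≥ |S : T|, while the norm of σ gives d² ≤ |S : T|;
hence σ vanishes off T. This is `character_eq_zero_of_intertwiningMap_sylow`.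

To use it, suitable χ are found from nonzero elements of ℂ[G], each of which acts nontrivially in
some irreducible representation. For (1) the element is (x - 1)(n - 1) with x a commutator and n in
N; for (2) it is (n - 1)F with F a matrix coefficient of ϑ. In (3), N ⊆ ker ϑ would force N ≤ S ∩ N
= 1, so (2) applies. -/

/-- A finite group of invertible complex matrices is conjugate to a group of unitary matrices. -/
theorem exists_conj_unitary {G : Type*} [Group G] [Finite G] {ι : Type*} [Fintype ι]
    [DecidableEq ι] (A : G →* Matrix ι ι ℂ) :
    ∃ K L : Matrix ι ι ℂ, L * K = 1 ∧ K * L = 1 ∧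
      ∀ g, (K * A g * L)ᴴ * (K * A g * L) = 1 := by
  classical
  have := Fintype.ofFinite G
  -- `H` is the averaged Hermitian form; writing it as `Kᴴ * K` makes conjugation by `K` unitarize
  -- `A`.
  let H : Matrix ι ι ℂ := ∑ g, (A g)ᴴ * A g
  have hpos : H.PosDef := by
    have h1 : H = (A 1)ᴴ * A 1 + ∑ g ∈ Finset.univ.erase 1, (A g)ᴴ * A g :=
      (Finset.add_sum_erase _ _ (Finset.mem_univ _)).symm
    rw [h1]
    refine PosDef.add_posSemidef (by simpa using PosDef.one) ?_
    exact posSemidef_sum _ fun g _ => posSemidef_conjTranspose_mul_self _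
  have hinv (x : G) : (A x)ᴴ * H * A x = H := by
    simp only [H, Finset.mul_sum, Finset.sum_mul]
    refine Fintype.sum_equiv (Equiv.mulRight x) _ _ fun g => ?_
    simp [Matrix.mul_assoc]
  obtain ⟨K, hK⟩ : ∃ K : Matrix ι ι ℂ, H = Kᴴ * K := by
    open scoped MatrixOrder in
    exact CStarAlgebra.nonneg_iff_eq_star_mul_self.mp hpos.posSemidef.nonneg
  have hdet : IsUnit K.det := by
    have := (Matrix.isUnit_iff_isUnit_det _).mp hpos.isUnit
    rw [hK, det_mul] at this
    exact isUnit_of_mul_isUnit_right this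
  have h1 := K.mul_nonsing_inv hdet
  refine ⟨K, K⁻¹, K.nonsing_inv_mul hdet, h1, fun g => ?_⟩
  have h2 : (K⁻¹)ᴴ * Kᴴ = 1 := by rw [← conjTranspose_mul, h1, conjTranspose_one]
  calc (K * A g * K⁻¹)ᴴ * (K * A g * K⁻¹)
      = (K⁻¹)ᴴ * ((A g)ᴴ * (Kᴴ * K) * A g) * K⁻¹ := by
        simp only [conjTranspose_mul, Matrix.mul_assoc]
    _ = ((K⁻¹)ᴴ * Kᴴ) * (K * K⁻¹) := by
        rw [← hK, hinv, hK]; simp only [Matrix.mul_assoc]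
    _ = 1 := by rw [h1, h2, one_mul]

/-! ### Character values and scalar action -/

section FiniteDimensional

variable {G V : Type*} [Group G] [Finite G] [AddCommGroup V] [Module ℂ V] [FiniteDimensional ℂ V]

/-- A complex representation of a finite group is unitary in a suitable basis. -/
theorem exists_unitary_form (ρ : Representation ℂ G V) :
    ∃ Φ : Module.End ℂ V ≃ₐ[ℂ]
        Matrix (Fin (Module.finrank ℂ V)) (Fin (Module.finrank ℂ V)) ℂ,
      (∀ f, (Φ f).trace = LinearMap.trace ℂ V f) ∧ ∀ g, (Φ (ρ g))ᴴ * Φ (ρ g) = 1 := by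
  let b := Module.finBasis ℂ V
  obtain ⟨K, L, hLK, hKL, hU⟩ := exists_conj_unitary
    ((LinearMap.toMatrixAlgEquiv b).toRingEquiv.toMonoidHom.comp ρ)
  let u : (Matrix (Fin (Module.finrank ℂ V)) (Fin (Module.finrank ℂ V)) ℂ)ˣ := ⟨K, L, hKL, hLK⟩
  refine ⟨(LinearMap.toMatrixAlgEquiv b).trans
    (MulSemiringAction.toAlgEquiv ℂ _ (ConjAct.toConjAct u)), fun f => ?_, fun g => ?_⟩
  · rw [LinearMap.trace_eq_matrix_trace ℂ b]
    change (K * _ * L).trace = _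
    rw [Matrix.trace_mul_comm, ← Matrix.mul_assoc, hLK, one_mul]
    rfl
  · exact hU g

theorem character_inv (ρ : Representation ℂ G V) (g : G) :
    ρ.character g⁻¹ = star (ρ.character g) := by
  obtain ⟨Φ, htr, hU⟩ := exists_unitary_form ρ
  have h : Φ (ρ g⁻¹) = (Φ (ρ g))ᴴ := by
    have : Φ (ρ g) * Φ (ρ g⁻¹) = 1 := by rw [← map_mul, ← map_mul]; simp
    exact (left_inv_eq_right_inv (hU g) this).symm
  rw [character, ← htr, h, trace_conjTranspose, htr, character]

theorem character_mul_inv (ρ : Representation ℂ G V) (g : G) :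
    ρ.character g * ρ.character g⁻¹ = ((‖ρ.character g‖ ^ 2 : ℝ) : ℂ) := by
  rw [character_inv, Complex.star_def, Complex.mul_conj']
  push_cast; rfl

/-- An element whose character value has the largest possible absolute value acts as a scalar. -/
theorem apply_eq_smul_one_of_norm_character (ρ : Representation ℂ G V) [Nontrivial V] {g : G}
    (hg : ‖ρ.character g‖ = Module.finrank ℂ V) :
    ρ g = (ρ.character g / Module.finrank ℂ V) • (1 : Module.End ℂ V) := by
  obtain ⟨Φ, htr, hU⟩ := exists_unitary_form ρ
  have hn : (Module.finrank ℂ V : ℂ) ≠ 0 := by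
    exact_mod_cast (Module.finrank_pos (R := ℂ) (M := V)).ne'
  set n : ℂ := (Module.finrank ℂ V : ℂ) with hndef
  set t := ρ.character g with ht
  have hstar : star n = n := by simp [hndef]
  have htt : t * star t = n * n := by
    rw [Complex.star_def, Complex.mul_conj', hg]; push_cast; rw [sq]
  -- The squared Frobenius norm of this difference is n - |t|²/n = 0.
  have h0 : Φ (ρ g) - (t / n) • 1 = 0 := by
    rw [← trace_conjTranspose_mul_self_eq_zero_iff]
    have htr' : (Φ (ρ g)).trace = t := htr _
    rw [conjTranspose_sub, conjTranspose_smul, conjTranspose_one, sub_mul, mul_sub, mul_sub, hU]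
    simp only [trace_sub, trace_one, smul_mul_assoc, mul_smul_comm, one_mul, mul_one, trace_smul,
      trace_conjTranspose, htr', Fintype.card_fin, smul_eq_mul, star_div₀, hstar, ← hndef]
    field_simp
    linear_combination (-1 : ℂ) * htt
  apply Φ.injective
  rw [sub_eq_zero.mp h0, map_smul, map_one]

omit [FiniteDimensional ℂ V] in
theorem norm_eq_one_of_apply_eq_smul_one (ρ : Representation ℂ G V) [Nontrivial V] {g : G} {c : ℂ}
    (h : ρ g = c • 1) : ‖c‖ = 1 := by
  have h1 : c ^ Nat.card G = 1 := by
    have : (c ^ Nat.card G) • (1 : Module.End ℂ V) = (1 : ℂ) • 1 := by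
      rw [← one_pow (M := Module.End ℂ V) (Nat.card G), ← smul_pow, ← h, ← map_pow, pow_card_eq_one',
        map_one, one_pow, one_smul]
    exact smul_left_injective ℂ (one_ne_zero) this
  exact Complex.norm_eq_one_of_pow_eq_one h1 Nat.card_pos.ne'

/-- The subgroup of elements acting as scalars. -/
def scalarSubgroup {G V : Type*} [Group G] [AddCommGroup V] [Module ℂ V]
    (ρ : Representation ℂ G V) : Subgroup G where
  carrier := {g | ∃ c : ℂ, ρ g = c • 1}
  mul_mem' := by
    rintro a b ⟨c, hc⟩ ⟨d, hd⟩
    exact ⟨c * d, by rw [map_mul, hc, hd, smul_mul_smul_comm, one_mul]⟩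
  one_mem' := ⟨1, by simp⟩
  inv_mem' := by
    rintro a ⟨c, hc⟩
    have h : ρ a⁻¹ * ρ a = 1 := by rw [← map_mul]; simp
    refine ⟨c⁻¹, ?_⟩
    -- The scalar 0 can occur only on the zero space.
    rcases eq_or_ne c 0 with rfl | h0
    · rw [hc] at h
      have h10 : (1 : Module.End ℂ V) = 0 := by rw [← h]; simp
      rw [← mul_one (ρ a⁻¹), h10]; simp
    · rw [hc, mul_smul_comm, mul_one] at h
      rw [← h, smul_smul, inv_mul_cancel₀ h0, one_smul]

instance scalarSubgroup_normal {G V : Type*} [Group G] [AddCommGroup V] [Module ℂ V]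
    (ρ : Representation ℂ G V) : (scalarSubgroup ρ).Normal where
  conj_mem := by
    rintro a ⟨c, hc⟩ g
    refine ⟨c, ?_⟩
    rw [map_mul, map_mul, hc, mul_smul_comm, mul_one, smul_mul_assoc, ← map_mul]
    simp

omit [Finite G] in
theorem character_of_apply_eq_smul_one (ρ : Representation ℂ G V) {g : G} {c : ℂ}
    (h : ρ g = c • 1) : ρ.character g = c * Module.finrank ℂ V := by
  rw [character, h, map_smul, LinearMap.trace_one, smul_eq_mul]

theorem mem_charCenter_iff (ρ : Representation ℂ G V) [Nontrivial V] {g : G} :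
    ((‖ρ.character g‖ : ℂ) = ρ.character 1) ↔ g ∈ scalarSubgroup ρ := by
  rw [char_one]
  constructor
  · intro h
    exact ⟨_, apply_eq_smul_one_of_norm_character ρ (by exact_mod_cast h)⟩
  · rintro ⟨c, hc⟩
    rw [character_of_apply_eq_smul_one ρ hc, norm_mul, norm_eq_one_of_apply_eq_smul_one ρ hc]
    simp

theorem mem_charKer_iff (ρ : Representation ℂ G V) [Nontrivial V] {g : G} :
    ρ.character g = ρ.character 1 ↔ ρ g = 1 := by
  refine ⟨fun h => ?_, fun h => by rw [char_one, character, h, LinearMap.trace_one]⟩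
  rw [char_one] at h
  have hn : (Module.finrank ℂ V : ℂ) ≠ 0 := by
    exact_mod_cast (Module.finrank_pos (R := ℂ) (M := V)).ne'
  have := apply_eq_smul_one_of_norm_character ρ (g := g) (by rw [h]; simp)
  rwa [h, div_self hn, one_smul] at this

end FiniteDimensional

/-! ### Irreducible representations from the group algebra -/

open scoped MonoidAlgebra

theorem isIrreducible_of_equiv {G V W : Type*} [Group G] [AddCommGroup V] [Module ℂ V]
    [AddCommGroup W] [Module ℂ W] {ρ : Representation ℂ G V} {σ : Representation ℂ G W}
    (e : Representation.Equiv ρ σ) (h : ρ.IsIrreducible) : σ.IsIrreducible := by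
  rw [irreducible_iff_isSimpleModule_asModule] at h ⊢
  let f := IntertwiningMap.equivLinearMapAsModule ρ σ e.toIntertwiningMap
  have hf : Function.Bijective f := e.toLinearEquiv.bijective
  exact IsSimpleModule.congr (LinearEquiv.ofBijective f hf).symm

/-- Every finite-dimensional representation is equivalent to one on `ℂⁿ`. -/
theorem exists_equiv_fin {G V : Type*} [Group G] [AddCommGroup V] [Module ℂ V]
    [FiniteDimensional ℂ V] (ρ : Representation ℂ G V) :
    ∃ (n : ℕ) (σ : Representation ℂ G (Fin n → ℂ)), Nonempty (Representation.Equiv ρ σ) := by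
  let e := (Module.finBasis ℂ V).equivFun
  refine ⟨_, (e.conjAlgEquiv ℂ).toRingEquiv.toMonoidHom.comp ρ, ⟨Representation.Equiv.mk e fun g => ?_⟩⟩
  ext v
  simp

theorem asAlgebraHom_comm {G V W : Type*} [Group G] [AddCommGroup V] [Module ℂ V]
    [AddCommGroup W] [Module ℂ W] {ρ : Representation ℂ G V} {σ : Representation ℂ G W}
    (f : IntertwiningMap ρ σ) (a : ℂ[G]) (v : V) :
    f (ρ.asAlgebraHom a v) = σ.asAlgebraHom a (f v) :=
  (IntertwiningMap.equivLinearMapAsModule ρ σ f).map_smul a (ρ.asModuleEquiv.symm v)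

/-- Irreducible representations separate the elements of the group algebra. -/
theorem exists_isIrreducible_asAlgebraHom_ne_zero {G : Type*} [Group G] [Finite G] {a : ℂ[G]}
    (ha : a ≠ 0) : ∃ (n : ℕ) (ρ : Representation ℂ G (Fin n → ℂ)),
      ρ.IsIrreducible ∧ ρ.asAlgebraHom a ≠ 0 := by
  -- The radical vanishes, so some maximal left ideal `m` misses `a`; then `a` moves the class of 1
  -- in ℂ[G]/m to a nonzero element.
  have hJ : Module.jacobson ℂ[G] ℂ[G] = ⊥ := IsSemisimpleModule.jacobson_eq_bot _ _
  obtain ⟨m, hm, ham⟩ : ∃ m : Submodule ℂ[G] ℂ[G], IsCoatom m ∧ a ∉ m := by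
    by_contra! h
    apply ha
    rw [← Submodule.mem_bot ℂ[G], ← hJ, Module.jacobson, Submodule.mem_sInf]
    exact fun m hm => h m hm
  have hsimple : IsSimpleModule ℂ[G] (ℂ[G] ⧸ m) := isSimpleModule_iff_isCoatom.mpr hm
  let τ : Representation ℂ G (ℂ[G] ⧸ m) := ofModule' (ℂ[G] ⧸ m)
  have hτ (b : ℂ[G]) (x : ℂ[G] ⧸ m) : τ.asAlgebraHom b x = b • x := by
    have : τ.asAlgebraHom = Algebra.lsmul ℂ ℂ (ℂ[G] ⧸ m) :=
      (MonoidAlgebra.lift ℂ _ G).apply_symm_apply _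
    rw [this]; rfl
  have hirr : τ.IsIrreducible := by
    rw [irreducible_iff_isSimpleModule_asModule]
    let f : τ.asModule ≃ₗ[ℂ[G]] (ℂ[G] ⧸ m) :=
      { τ.asModuleEquiv with map_smul' := fun b x => hτ b x }
    exact IsSimpleModule.congr f
  have : FiniteDimensional ℂ (ℂ[G] ⧸ m) := inferInstance
  obtain ⟨n, ρ, ⟨e⟩⟩ := exists_equiv_fin τ
  refine ⟨n, ρ, isIrreducible_of_equiv e hirr, fun h0 => ham ?_⟩
  have h1 := asAlgebraHom_comm e.toIntertwiningMap a (Submodule.Quotient.mk 1)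
  rw [h0, hτ, ← Submodule.Quotient.mk_smul] at h1
  have h2 : (Submodule.Quotient.mk (a • (1 : ℂ[G])) : ℂ[G] ⧸ m) = 0 :=
    e.toLinearEquiv.injective (h1.trans (map_zero e.toLinearEquiv).symm)
  simpa using (Submodule.Quotient.mk_eq_zero m).mp h2

/-- Every nonzero representation of a finite group has an irreducible subrepresentation. -/
theorem exists_isIrreducible_intertwiningMap_ne_zero {G V : Type*} [Group G] [Finite G]
    [AddCommGroup V] [Module ℂ V] [FiniteDimensional ℂ V] [Nontrivial V]
    (ρ : Representation ℂ G V) : ∃ (n : ℕ) (σ : Representation ℂ G (Fin n → ℂ)),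
      σ.IsIrreducible ∧ ∃ u : IntertwiningMap σ ρ, u ≠ 0 := by
  have : Nontrivial ρ.asModule := inferInstanceAs (Nontrivial V)
  obtain ⟨m, hm⟩ := IsSemisimpleModule.exists_simple_submodule ℂ[G] ρ.asModule
  let τ : Representation ℂ G m := ofModule' m
  have hτ (b : ℂ[G]) (x : m) : τ.asAlgebraHom b x = b • x := by
    have : τ.asAlgebraHom = Algebra.lsmul ℂ ℂ m :=
      (MonoidAlgebra.lift ℂ _ G).apply_symm_apply _
    rw [this]; rfl
  let f : τ.asModule ≃ₗ[ℂ[G]] m :=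
    { τ.asModuleEquiv with map_smul' := fun b x => hτ b x }
  have hirr : τ.IsIrreducible := by
    rw [irreducible_iff_isSimpleModule_asModule]
    exact IsSimpleModule.congr f
  have : FiniteDimensional ℂ m := inferInstanceAs (FiniteDimensional ℂ (m.restrictScalars ℂ))
  obtain ⟨n, σ, ⟨e⟩⟩ := exists_equiv_fin τ
  let w : IntertwiningMap τ ρ :=
    (IntertwiningMap.equivLinearMapAsModule τ ρ).symm (m.subtype ∘ₗ f.toLinearMap)
  refine ⟨n, σ, isIrreducible_of_equiv e hirr, w.comp e.symm.toIntertwiningMap, fun h0 => ?_⟩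
  have := IsSimpleModule.nontrivial ℂ[G] m
  obtain ⟨x, hx⟩ := exists_ne (0 : m)
  have h1 : w (e.symm (e x)) = 0 := congrArg (fun q : IntertwiningMap σ ρ => q (e x)) h0
  have h2 : e.symm (e x) = x := e.toLinearEquiv.symm_apply_apply x
  rw [h2] at h1
  exact hx (Subtype.ext h1)

/-- The first three divisibility conditions make q the exact p-part p^(2v) of n². Cancelling p^v in
`h3` leaves p^v ∣ d. -/
theorem le_sq_of_mul_eq_mul {p k q n r a d : ℕ} (hp : p.Prime) (hq : q = p ^ k)
    (h1 : q ∣ n ^ 2) (h2 : n ^ 2 ∣ q * r) (hr : ¬ p ∣ r) (h3 : a * q = n * d) (hn : n ≠ 0)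
    (hd : d ≠ 0) : q ≤ d ^ 2 := by
  obtain ⟨v, m, hm, rfl⟩ := Nat.exists_eq_pow_mul_and_not_dvd hn p hp.ne_one
  subst hq
  have hpm : (p.Coprime m) := (hp.coprime_iff_not_dvd).mpr hm
  have hpr : (p.Coprime r) := (hp.coprime_iff_not_dvd).mpr hr
  have hk1 : k ≤ v * 2 := by
    rw [mul_pow, ← pow_mul] at h1
    exact (Nat.pow_dvd_pow_iff_le_right hp.one_lt).mp
      ((Nat.Coprime.pow k 2 hpm).dvd_of_dvd_mul_right h1)
  have hk2 : v * 2 ≤ k := by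
    have h2' : p ^ (v * 2) ∣ p ^ k * r := by
      rw [pow_mul]; exact (pow_dvd_pow_of_dvd (dvd_mul_right _ _) 2).trans h2
    exact (Nat.pow_dvd_pow_iff_le_right hp.one_lt).mp
      ((Nat.Coprime.pow_left _ hpr).dvd_of_dvd_mul_right h2')
  obtain rfl : k = v * 2 := le_antisymm hk1 hk2
  have hpos : 0 < p ^ v := pow_pos hp.pos v
  have h4 : a * p ^ v = m * d := by
    apply Nat.eq_of_mul_eq_mul_left hpos
    rw [← mul_assoc (p ^ v) m d, ← h3]; ring
  have h5 : p ^ v ∣ d :=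
    (Nat.Coprime.pow_left v hpm).dvd_of_dvd_mul_left (h4 ▸ dvd_mul_left _ _)
  rw [pow_mul]
  exact Nat.pow_le_pow_left (Nat.le_of_dvd (Nat.pos_of_ne_zero hd) h5) 2

/-! ### Central type and restriction to a Sylow subgroup -/

section

variable {G V : Type*} [Group G] [AddCommGroup V] [Module ℂ V]

theorem nontrivial_of_isIrreducible {ρ : Representation ℂ G V} (h : ρ.IsIrreducible) :
    Nontrivial V :=
  IsSimpleModule.nontrivial ℂ[G] ρ.asModule

/-- Irreducible representations separate the complex functions on a finite group. -/
theorem exists_isIrreducible_sum_smul_ne_zero [Fintype G] {c : G → ℂ} (hc : c ≠ 0) :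
    ∃ (n : ℕ) (ρ : Representation ℂ G (Fin n → ℂ)), ρ.IsIrreducible ∧ ∑ g, c g • ρ g ≠ 0 := by
  classical
  have ha : ∑ g, MonoidAlgebra.single g (c g) ≠ 0 := by
    obtain ⟨x, hx⟩ := Function.ne_iff.mp hc
    intro h0
    apply hx
    have := congrArg (fun b : ℂ[G] => b.coeff x) h0
    simpa [MonoidAlgebra.coeff_single, Finsupp.single_apply] using this
  obtain ⟨n, ρ, hρ, h⟩ := exists_isIrreducible_asAlgebraHom_ne_zero ha
  refine ⟨n, ρ, hρ, ?_⟩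
  simpa [map_sum, asAlgebraHom_single] using h

variable [FiniteDimensional ℂ V]

theorem sum_norm_sq_character [Fintype G] {ρ : Representation ℂ G V} (h : ρ.IsIrreducible) :
    ∑ g, ‖ρ.character g‖ ^ 2 = Nat.card G := by
  have hG : (Nat.card G : ℂ) ≠ 0 := by exact_mod_cast Nat.card_pos.ne'
  have := invertibleOfNonzero hG
  have h1 := char_orthonormal ρ ρ
  rw [if_pos ⟨Representation.Equiv.refl ρ⟩, inv_mul_eq_one₀ hG] at h1
  simp only [character_mul_inv] at h1
  exact_mod_cast h1.symm

/-- A character vanishing off the scalar subgroup is fully ramified over it. -/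
theorem finrank_sq_eq_index [Finite G] {ρ : Representation ℂ G V} (h : ρ.IsIrreducible)
    (hc : ∀ g ∉ scalarSubgroup ρ, ρ.character g = 0) :
    Module.finrank ℂ V ^ 2 = (scalarSubgroup ρ).index := by
  classical
  have := Fintype.ofFinite G
  have := nontrivial_of_isIrreducible h
  have h1 (g : G) : ‖ρ.character g‖ ^ 2 =
      if g ∈ scalarSubgroup ρ then (Module.finrank ℂ V : ℝ) ^ 2 else 0 := by
    split_ifs with hg
    · have := (mem_charCenter_iff ρ).mpr hg
      rw [char_one] at this
      rw [show ‖ρ.character g‖ = Module.finrank ℂ V by exact_mod_cast this]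
    · simp [hc g hg]
  have h2 := sum_norm_sq_character h
  simp only [h1, ← Finset.sum_filter, Finset.sum_const, nsmul_eq_mul] at h2
  rw [← Fintype.card_subtype, ← (scalarSubgroup ρ).card_mul_index, ← Nat.card_eq_fintype_card,
    Nat.cast_mul] at h2
  have hZ : ((Nat.card (scalarSubgroup ρ) : ℕ) : ℝ) ≠ 0 := by exact_mod_cast Nat.card_pos.ne'
  exact_mod_cast mul_left_cancel₀ hZ h2

/-- If `ρ` is irreducible and its character vanishes off the scalar subgroup, then so do the
characters of the irreducible constituents of its restriction to a Sylow subgroup. -/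
theorem character_eq_zero_of_intertwiningMap_sylow [Finite G] {ρ : Representation ℂ G V}
    (h : ρ.IsIrreducible) (hc : ∀ g ∉ scalarSubgroup ρ, ρ.character g = 0) {p : ℕ}
    [hp : Fact p.Prime] (S : Sylow p G) {W : Type*} [AddCommGroup W] [Module ℂ W]
    [FiniteDimensional ℂ W] {σ : Representation ℂ S W} (hσ : σ.IsIrreducible)
    (u : IntertwiningMap σ (ρ.comp (S : Subgroup G).subtype)) (hu : u ≠ 0) (s : S)
    (hs : (s : G) ∉ scalarSubgroup ρ) : σ.character s = 0 := by
  classical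
  have := Fintype.ofFinite S
  have := nontrivial_of_isIrreducible h
  have := nontrivial_of_isIrreducible hσ
  set Z := scalarSubgroup ρ
  set T := Z.subgroupOf (S : Subgroup G)
  let ρ' : Representation ℂ S V := ρ.comp (S : Subgroup G).subtype
  set n := Module.finrank ℂ V
  set d := Module.finrank ℂ W with hd
  have hinj : Function.Injective u := (IsIrreducible.injective_or_eq_zero u).resolve_right hu
  have hscalar (t : S) (c : ℂ) (ht : ρ t = c • 1) : σ t = c • 1 := by
    ext w
    apply hinj
    rw [u.isIntertwining]
    change ρ t (u w) = u (c • w)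
    rw [ht, map_smul]; rfl
  have hθ (t : S) (ht : t ∈ T) : ‖σ.character t‖ = d := by
    obtain ⟨c, hct⟩ := ht
    have := hscalar t c hct
    rw [character_of_apply_eq_smul_one σ this, norm_mul, norm_eq_one_of_apply_eq_smul_one σ this]
    simp [hd]
  have hprod (t : S) : ρ'.character t * σ.character t⁻¹ = if t ∈ T then (n * d : ℂ) else 0 := by
    split_ifs with ht
    · obtain ⟨c, hct⟩ := ht
      have hσt := hscalar t c hct
      have hc1 := norm_eq_one_of_apply_eq_smul_one σ hσt
      have hρt : ρ' t = c • 1 := hct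
      rw [character_inv, character_of_apply_eq_smul_one σ hσt,
        character_of_apply_eq_smul_one ρ' hρt, star_mul', Complex.star_def,
        map_natCast]
      have : c * (starRingEnd ℂ) c = 1 := by rw [Complex.mul_conj', hc1]; simp
      linear_combination (n * d : ℂ) * this
    · have : ρ'.character t = 0 := hc t ht
      rw [this, zero_mul]
  have hcard : Nat.card T * T.index = Nat.card S := T.card_mul_index
  have hT0 : 0 < Nat.card T := Nat.card_pos
  -- Here `a` is the multiplicity of σ in the restriction of ρ.
  obtain ⟨a, ha⟩ : ∃ a : ℕ, a * T.index = n * d := by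
    have hS : (Nat.card S : ℂ) ≠ 0 := by exact_mod_cast Nat.card_pos.ne'
    have := invertibleOfNonzero hS
    refine ⟨Module.finrank ℂ (IntertwiningMap σ ρ'), ?_⟩
    have h1 := card_inv_mul_sum_char_mul_char_eq_finrank σ ρ'
    rw [inv_mul_eq_iff_eq_mul₀ hS] at h1
    simp only [hprod, ← Finset.sum_filter, Finset.sum_const, nsmul_eq_mul] at h1
    rw [← Fintype.card_subtype, ← hcard, ← Nat.card_eq_fintype_card] at h1
    have h2 : Nat.card T * (n * d) =
        Nat.card T * T.index * Module.finrank ℂ (IntertwiningMap σ ρ') := by exact_mod_cast h1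
    rw [mul_assoc] at h2
    rw [Nat.eq_of_mul_eq_mul_left hT0 h2, mul_comm]
  have hle : T.index ≤ d ^ 2 := by
    obtain ⟨k, hk⟩ := S.isPGroup'.index T
    have hsq := finrank_sq_eq_index h hc
    refine le_sq_of_mul_eq_mul hp.out hk ?_ ?_ S.not_dvd_index ha
      Module.finrank_pos.ne' Module.finrank_pos.ne'
    · rw [hsq]; exact Subgroup.relIndex_dvd_index_of_normal _ _
    · rw [hsq]
      change Z.index ∣ Z.relIndex S * (S : Subgroup G).index
      rw [← Subgroup.inf_relIndex_right, Subgroup.relIndex_mul_index inf_le_right]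
      exact Subgroup.index_dvd_of_le inf_le_left
  -- A nonzero value off T would make the sum of |σ|² exceed |T| d² ≥ |S|.
  by_contra hne
  have hsum := sum_norm_sq_character hσ
  have hlt : ∑ t ∈ Finset.univ.filter (· ∈ T), ‖σ.character t‖ ^ 2 < ∑ t, ‖σ.character t‖ ^ 2 :=
    Finset.sum_lt_sum_of_subset (Finset.filter_subset _ _) (Finset.mem_univ s)
      (fun hsT => hs (Finset.mem_filter.mp hsT).2) (by positivity) fun _ _ _ => by positivity
  rw [hsum, Finset.sum_congr rfl fun t ht => by rw [hθ t (Finset.mem_filter.mp ht).2],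
    Finset.sum_const, ← Fintype.card_subtype, ← Nat.card_eq_fintype_card, nsmul_eq_mul,
    ← hcard] at hlt
  have hlt' : Nat.card T * d ^ 2 < Nat.card T * T.index := by exact_mod_cast hlt
  exact absurd (Nat.lt_of_mul_lt_mul_left hlt') (not_lt.mpr hle)

/-- The central elements of a group act as scalars in an irreducible representation. -/
theorem mem_scalarSubgroup_of_mem_center {ρ : Representation ℂ G V} (h : ρ.IsIrreducible) {z : G}
    (hz : z ∈ Subgroup.center G) : z ∈ scalarSubgroup ρ := by
  let f : IntertwiningMap ρ ρ := ⟨ρ z, fun g => by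
    change ρ z * ρ g = ρ g * ρ z
    rw [← map_mul, ← map_mul, Subgroup.mem_center_iff.mp hz g]⟩
  obtain ⟨c, hc⟩ := (IsIrreducible.algebraMap_intertwiningMap_bijective_of_isAlgClosed (ρ := ρ)).2 f
  refine ⟨c, ?_⟩
  have := congrArg IntertwiningMap.toLinearMap hc
  exact this.symm

end

/-! ### Choosing characters over N -/

section Main

variable {G : Type*} [Group G] [Finite G] {N : Subgroup G}

theorem character_eq_zero_of_notMem_scalarSubgroup
    (h : ∀ χ ∈ IrrRel N, HasCentralType χ) {n : ℕ} {ρ : Representation ℂ G (Fin n → ℂ)}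
    (hρ : ρ.IsIrreducible) {x : G} (hx : x ∈ N) (hx1 : ρ x ≠ 1) :
    ∀ g ∉ scalarSubgroup ρ, ρ.character g = 0 := by
  have := nontrivial_of_isIrreducible hρ
  intro g hg
  refine h ρ.character ⟨⟨n, ρ, hρ, rfl⟩, fun hN => hx1 ?_⟩ g fun hgc => hg ?_
  · exact (mem_charKer_iff ρ).mp (hN hx)
  · exact (mem_charCenter_iff ρ).mp hgc

/-- A central z of S acts on σ by a nonzero scalar, so σ(z) ≠ 0 and z must be scalar in ρ. Then ρ
kills every commutator [g, z], against the choice of ρ. -/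
theorem mem_center_of_mem_center_sylow (hN : N ≠ ⊥) (h : ∀ χ ∈ IrrRel N, HasCentralType χ)
    {p : ℕ} [Fact p.Prime] (S : Sylow p G) {z : S}
    (hz : z ∈ Subgroup.center (S : Subgroup G)) : (z : G) ∈ Subgroup.center G := by
  classical
  have := Fintype.ofFinite G
  rw [Subgroup.mem_center_iff]
  intro g
  by_contra hne
  obtain ⟨n, hn, hn1⟩ := N.bot_or_exists_ne_one.resolve_left hN
  set x : G := g * z * g⁻¹ * (z : G)⁻¹ with hx
  have hx1 : x ≠ 1 := fun h1 => hne (by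
    rwa [hx, mul_inv_eq_one, mul_inv_eq_iff_eq_mul] at h1)
  -- These are the coefficients of (x - 1)(n - 1); the one at 1 is 1 or 2, as x and n are
  -- nontrivial.
  let c : G → ℂ := Pi.single (x * n) 1 - Pi.single x 1 - Pi.single n 1 + Pi.single 1 1
  have hc : c ≠ 0 := by
    intro h0
    have h1 : c 1 = 0 := congrFun h0 1
    simp only [c, Pi.add_apply, Pi.sub_apply, Pi.single_apply, hx1.symm, hn1.symm, if_false,
      if_true] at h1
    split_ifs at h1 <;> norm_num at h1
  obtain ⟨k, ρ, hρ, hsum⟩ := exists_isIrreducible_sum_smul_ne_zero hc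
  have hsum' : ∑ g, c g • ρ g = (ρ x - 1) * (ρ n - 1) := by
    simp only [c, Pi.add_apply, Pi.sub_apply, Pi.single_apply, add_smul, sub_smul, ite_smul,
      one_smul, zero_smul, Finset.sum_add_distrib, Finset.sum_sub_distrib, Finset.sum_ite_eq',
      Finset.mem_univ, if_true, map_mul, map_one]
    rw [sub_mul, mul_sub, mul_one, one_mul]
    abel
  rw [hsum'] at hsum
  have hρn : ρ n ≠ 1 := fun h1 => hsum (by rw [h1, sub_self, mul_zero])
  have hρx : ρ x ≠ 1 := fun h1 => hsum (by rw [h1, sub_self, zero_mul])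
  have hvan := character_eq_zero_of_notMem_scalarSubgroup h hρ hn hρn
  have := nontrivial_of_isIrreducible hρ
  obtain ⟨m, σ, hσ, u, hu⟩ := exists_isIrreducible_intertwiningMap_ne_zero
    (ρ.comp (S : Subgroup G).subtype)
  have := nontrivial_of_isIrreducible hσ
  have hzρ : (z : G) ∈ scalarSubgroup ρ := by
    by_contra hz'
    have h0 := character_eq_zero_of_intertwiningMap_sylow hρ hvan S hσ u hu z hz'
    have h1 := (mem_charCenter_iff σ).mpr (mem_scalarSubgroup_of_mem_center hσ hz)
    rw [h0, char_one, norm_zero] at h1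
    exact Module.finrank_pos.ne (by exact_mod_cast h1)
  obtain ⟨b, hb⟩ := hzρ
  apply hρx
  have hcomm : ρ (g * z * g⁻¹) = ρ z := by
    rw [map_mul, map_mul, hb, mul_smul_comm, mul_one, smul_mul_assoc, ← map_mul]
    simp
  rw [hx, map_mul, hcomm, ← map_mul, mul_inv_cancel, map_one]

/-- An irreducible ρ must both lie over σ and be nontrivial at n. Nonvanishing of ρ on (n - 1)F
ensures both at once. -/
theorem hasCentralType_of_not_subset (h : ∀ χ ∈ IrrRel N, HasCentralType χ)
    {p : ℕ} [Fact p.Prime] (S : Sylow p G) {ϑ : S → ℂ} (hϑ : ϑ ∈ Irr (S : Subgroup G))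
    (hNϑ : ¬ (N : Set G) ⊆ (S : Subgroup G).subtype '' charKer ϑ) : HasCentralType ϑ := by
  classical
  have := Fintype.ofFinite G
  have := Fintype.ofFinite S
  obtain ⟨m, σ, hσ, rfl⟩ := hϑ
  have := nontrivial_of_isIrreducible hσ
  obtain ⟨n, hn, hnϑ⟩ := Set.not_subset.mp hNϑ
  -- The choice ensures f(1) ≠ f(n) for the `f` below, so (n - 1)F has a nonzero coefficient at n.
  obtain ⟨w, i, hw⟩ : ∃ (w : Fin m → ℂ) (i : Fin m),
      (if hx : n ∈ S then σ ⟨n, hx⟩⁻¹ w i else 0) ≠ w i := by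
    split_ifs with hx
    · have hσn : σ ⟨n, hx⟩⁻¹ ≠ 1 := by
        intro h1
        refine hnϑ ⟨⟨n, hx⟩, (mem_charKer_iff σ).mpr ?_, rfl⟩
        rw [← mul_one (σ _), ← h1, ← map_mul, mul_inv_cancel, map_one, h1]
      obtain ⟨w, hw⟩ : ∃ w, σ ⟨n, hx⟩⁻¹ w ≠ w := by
        by_contra! h1
        exact hσn (LinearMap.ext h1)
      exact ⟨w, Function.ne_iff.mp hw⟩
    · obtain ⟨w, hw⟩ := exists_ne (0 : Fin m → ℂ)
      obtain ⟨i, hi⟩ := Function.ne_iff.mp hw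
      exact ⟨w, i, hi.symm⟩
  let f : G → ℂ := fun x => if hx : x ∈ S then σ ⟨x, hx⟩⁻¹ w i else 0
  have hf1 : f 1 = w i := by
    have h1 : (⟨1, one_mem _⟩ : S) = 1 := rfl
    simp only [f, dif_pos (one_mem S), h1, inv_one, map_one]; rfl
  have hc : (fun x => f (n⁻¹ * x) - f x) ≠ 0 := by
    refine Function.ne_iff.mpr ⟨n, ?_⟩
    simp only [inv_mul_cancel, hf1]
    exact sub_ne_zero.mpr hw.symm
  obtain ⟨k, ρ, hρ, hsum⟩ := exists_isIrreducible_sum_smul_ne_zero hc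
  have hsum' : ∑ g, (f (n⁻¹ * g) - f g) • ρ g = (ρ n - 1) * ∑ g, f g • ρ g := by
    rw [sub_mul, one_mul, Finset.mul_sum]
    rw [Finset.sum_congr rfl fun g _ => sub_smul (f (n⁻¹ * g)) (f g) (ρ g),
      Finset.sum_sub_distrib]
    congr 1
    refine Fintype.sum_equiv (Equiv.mulLeft n⁻¹) _ _ fun g => ?_
    rw [mul_smul_comm, ← map_mul]; simp
  rw [hsum'] at hsum
  have hρn : ρ n ≠ 1 := fun h1 => hsum (by rw [h1, sub_self, zero_mul])
  have hF : ∑ g, f g • ρ g ≠ 0 := fun h1 => hsum (by rw [h1, mul_zero])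
  obtain ⟨v, hv⟩ : ∃ v, (∑ g, f g • ρ g) v ≠ 0 := by
    by_contra! h1
    exact hF (LinearMap.ext h1)
  have hvan := character_eq_zero_of_notMem_scalarSubgroup h hρ hn hρn
  -- Averaging over S makes this map equivariant, and its value at `w` is F v ≠ 0.
  let u' : (Fin m → ℂ) →ₗ[ℂ] (Fin k → ℂ) :=
    ∑ s : S, ((LinearMap.proj i ∘ₗ σ s⁻¹ : (Fin m → ℂ) →ₗ[ℂ] ℂ).smulRight (ρ s v))
  have hu' (y : Fin m → ℂ) : u' y = ∑ s : S, (σ s⁻¹ y i) • ρ s v := by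
    simp [u', LinearMap.sum_apply]
  let u : IntertwiningMap σ (ρ.comp (S : Subgroup G).subtype) :=
    u'.intertwiningMap_of_isIntertwiningMap _ _ fun t y => by
      rw [hu', hu', map_sum]
      refine Fintype.sum_equiv (Equiv.mulLeft t⁻¹) _ _ fun s => ?_
      simp [← Module.End.mul_apply, ← map_mul]
  have hu : u ≠ 0 := by
    intro h0
    apply hv
    have h1 : u' w = 0 := congrArg (fun q : IntertwiningMap σ _ => q w) h0
    rw [← h1, hu', LinearMap.sum_apply]
    symm
    refine Finset.sum_of_injOn (fun s : S => (s : G)) (fun _ _ _ _ => Subtype.ext)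
      (fun _ _ => Finset.mem_coe.mpr (Finset.mem_univ _)) (fun g _ hg => ?_) fun s _ => ?_
    · have : g ∉ S := fun hgS => hg ⟨⟨g, hgS⟩, by simp, rfl⟩
      simp [f, this]
    · simp [f]
  intro s hs
  refine character_eq_zero_of_intertwiningMap_sylow hρ hvan S hσ u hu s fun hsρ => hs ?_
  obtain ⟨b, hb⟩ := hsρ
  refine (mem_charCenter_iff σ).mpr ⟨b, LinearMap.ext fun y => ?_⟩
  apply (IsIrreducible.injective_or_eq_zero u).resolve_right hu
  rw [u.isIntertwining]
  change ρ s (u y) = u (b • y)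
  rw [hb, map_smul]; rfl

end Main

end PartialGVZ

theorem mainTheorem7 {G : Type*} [Group G] [Finite G] (N : Subgroup G) [N.Normal] (hN : N ≠ ⊥)
    (h : ∀ χ ∈ PartialGVZ.IrrRel N, PartialGVZ.HasCentralType χ)
    (p : ℕ) [Fact p.Prime] (S : Sylow p G) :
    (S : Subgroup G) ⊓ Subgroup.center G =
        (Subgroup.center (S : Subgroup G)).map (S : Subgroup G).subtype ∧
      (∀ ϑ ∈ PartialGVZ.Irr (S : Subgroup G),
        ¬ (N : Set G) ⊆ (S : Subgroup G).subtype '' PartialGVZ.charKer ϑ →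
          PartialGVZ.HasCentralType ϑ) ∧
      ((S : Subgroup G) ⊓ N = ⊥ → PartialGVZ.IsGVZGroup (S : Subgroup G)) := by
  refine ⟨le_antisymm ?_ ?_, fun ϑ hϑ => PartialGVZ.hasCentralType_of_not_subset h S hϑ,
    fun hSN ϑ hϑ => PartialGVZ.hasCentralType_of_not_subset h S hϑ fun hsub => hN ?_⟩
  · rintro x ⟨hxS, hxG⟩
    refine ⟨⟨x, hxS⟩, Subgroup.mem_center_iff.mpr fun g => Subtype.ext ?_, rfl⟩
    exact Subgroup.mem_center_iff.mp hxG g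
  · rintro _ ⟨z, hz, rfl⟩
    exact ⟨z.2, PartialGVZ.mem_center_of_mem_center_sylow hN h S hz⟩
  · rw [eq_bot_iff, ← hSN]
    intro x hx
    obtain ⟨y, -, rfl⟩ := hsub hx
    exact ⟨y.2, hx⟩
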